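/- For a non-negative integer $n$ let $\sigma(n)$ be the sum of the base-two digits of $n$ and let $[n]$ be the set of powers of $2$ occurring in the base-two expansion of $n$. Let $S(n,k)$ be the Stirling numbers of the second kind and $\nu$ the $2$-adic valuation. For $1\le k\le n$, the almost minimum zero estimate for $\nu(S(n,k))$ is the bound $$\nu(S(n,k))\ \ge\ \sigma(k)-\sigma(n)+\#\bigl([n]\cap[n-k]\bigr);$$ it is called sharp if equality holds. $S(n,k)$ is a minimum zero case (MZC) if $\nu(S(n,k))=\sigma(k)-\sigma(n)$, and an almost minimum zero case (AMZC) if the almost minimum zero estimate is sharp but $S(n,k)$ is not an MZC. **Theorem 2.3.** Let $a,b,c,m,h$ be positive integers with $c$ odd, $0<a<2^{h+1}$ and $b2^{h+1}+2^h<2^m$, and put $n=c2^m+b2^{h+1}+2^h$ and $k=b2^{h+2}+a$. (i) If $a<2^{h+1}-1$, then $\sigma(k)-\sigma(n)+\#([n]\cap[n-k])=\sigma(a)-1$, i.e. the almost minimum zero estimate is $\nu(S(n,k))\ge\sigma(a)-1$. This estimate is not sharp, i.e. $\nu(S(n,k))\ge\sigma(a)$. (ii) If $a=2^{h+1}-1$,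 then again $\sigma(k)-\sigma(n)+\#([n]\cap[n-k])=\sigma(a)-1$, and $S(n,k)$ is an AMZC; that is, $\nu(S(n,k))=\sigma(a)-1=h$. -/

import Mathlib

namespace StirlingTwoAdic

/-- `σ(n)`: the sum of the base two digits of `n`. -/
def sigma (n : ℕ) : ℕ := (Nat.digits 2 n).sum

/-- `[n]`: the set of powers of two that occur in the base two expansion of `n`. -/
def twoPowers (n : ℕ) : Finset ℕ := n.bitIndices.toFinset.image (fun i => 2 ^ i)

/-- `ν(S(n,k))`: the 2-adic valuation of the Stirling number of the second kind.
It is meaningful when `S(n,k) ≠ 0`, in particular for `1 ≤ k ≤ n`. -/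
def nuS (n k : ℕ) : ℕ := padicValNat 2 (Nat.stirlingSecond n k)

/-- The minimum zero estimate `σ(k) - σ(n)` for `ν(S(n,k))`. -/
def mzEstimate (n k : ℕ) : ℤ := (sigma k : ℤ) - (sigma n : ℤ)

/-- The almost minimum zero estimate `σ(k) - σ(n) + #([n] ∩ [n-k])` for `ν(S(n,k))`
(used for `k ≤ n`). -/
def amzEstimate (n k : ℕ) : ℤ :=
  (sigma k : ℤ) - (sigma n : ℤ) + ((twoPowers n ∩ twoPowers (n - k)).card : ℤ)

/-- Minimum zero case: the minimum zero estimate is sharp. -/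
def IsMZC (n k : ℕ) : Prop := (nuS n k : ℤ) = mzEstimate n k

/-- Almost minimum zero case: the almost minimum zero estimate is sharp,
but it is not a minimum zero case. -/
def IsAMZC (n k : ℕ) : Prop := (nuS n k : ℤ) = amzEstimate n k ∧ ¬ IsMZC n k

end StirlingTwoAdic

namespace StirlingTwoAdic

/-! Write `h = t + 1`, `A = 2^(t+2) - a`, `B = 2^t (2b+1)`, so that `k + A = 4B`. The series `∑
S(i+k,k) Xⁱ` inverts `∏_{j≤k} (1 - jX)`. Completing this product to `4B` factors costs a numerator
congruent to `∏_{j<A} (1 + jX)` modulo `2^(t+2)`, while the full product is congruent to `(1-X²)^B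
(1 + 2^(t+1)(X + eX²))`.

If `A > 1`, then `σ(a) ≤ t+1`, the correction vanishes modulo `2^σ(a)`, and `S(n,k)` becomes a sum
of products of a first-kind number `s(A,j)` and a binomial coefficient. The bound `ν(s(A,j)) ≥
σ(j-1) - σ(A-1)` and Lucas' theorem make every term divisible by `2^σ(a)`.

If `A = 1`, the numerator is `1` and `n-k` is odd, so the even series `(1-X²)^(-B)` contributes only
through the correction: `2^(t+1)` times an odd binomial coefficient.

The estimate itself is digit counting: `n` and `n-k` share `σ(c)` digits. -/

/-! ### Binary digit sums and common digits -/

/-- The number of common binary digits `1` of `x` and `y`. -/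
def bitOverlap (x y : ℕ) : ℕ := (x.bitIndices.toFinset ∩ y.bitIndices.toFinset).card

lemma card_twoPowers_inter (x y : ℕ) :
    (twoPowers x ∩ twoPowers y).card = bitOverlap x y := by
  have hinj : Function.Injective (fun i : ℕ => 2 ^ i) := Nat.pow_right_injective le_rfl
  rw [twoPowers, twoPowers, ← Finset.image_inter _ _ hinj, Finset.card_image_of_injective _ hinj,
    bitOverlap]

lemma toFinset_bitIndices (n : ℕ) :
    n.bitIndices.toFinset =
      (n / 2).bitIndices.toFinset.map (addRightEmbedding 1) ∪ if n % 2 = 1 then {0} else ∅ := by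
  ext i
  simp only [List.mem_toFinset, Nat.mem_bitIndices, Finset.mem_union, Finset.mem_map,
    addRightEmbedding_apply]
  cases i with
  | zero => split_ifs with h <;> simp [Nat.testBit_zero, h]
  | succ i => split_ifs <;> simp [Nat.testBit_succ]

lemma bitOverlap_eq (x y : ℕ) :
    bitOverlap x y = bitOverlap (x / 2) (y / 2) + x % 2 * (y % 2) := by
  have h0 (s : Finset ℕ) : 0 ∉ s.map (addRightEmbedding 1) := by simp
  have h1 := Finset.card_map (addRightEmbedding 1)
    (s := (x / 2).bitIndices.toFinset ∩ (y / 2).bitIndices.toFinset)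
  rw [Finset.map_inter] at h1
  rw [bitOverlap, toFinset_bitIndices x, toFinset_bitIndices y, bitOverlap, ← h1]
  rcases Nat.mod_two_eq_zero_or_one x with hx | hx <;>
  rcases Nat.mod_two_eq_zero_or_one y with hy | hy
  · simp [hx, hy]
  · simp [hx, hy]
  · simp [hx, hy]
  · simp only [hx, hy, if_true, ← Finset.inter_union_distrib_right]
    rw [Finset.card_union_of_disjoint]
    · simp
    · simp

@[simp] lemma bitOverlap_zero_left (y : ℕ) : bitOverlap 0 y = 0 := by simp [bitOverlap]

@[simp] lemma bitOverlap_zero_right (x : ℕ) : bitOverlap x 0 = 0 := by simp [bitOverlap]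

lemma sigma_eq (n : ℕ) : sigma n = sigma (n / 2) + n % 2 := by
  rcases Nat.eq_zero_or_pos n with rfl | hn
  · simp [sigma]
  · rw [sigma, Nat.digits_def' (by norm_num) hn, List.sum_cons, sigma, add_comm]

lemma sigma_eq_bitOverlap (n : ℕ) : sigma n = bitOverlap n n := by
  induction n using Nat.strong_induction_on with
  | _ n ih =>
    rcases Nat.eq_zero_or_pos n with rfl | hn
    · simp [sigma]
    · rw [sigma_eq, bitOverlap_eq, ih _ (Nat.div_lt_self hn one_lt_two)]
      rcases Nat.mod_two_eq_zero_or_one n with h | h <;> simp [h]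

lemma bitOverlap_two_pow_mul_add (s x y : ℕ) {x₀ y₀ : ℕ} (hx : x₀ < 2 ^ s) (hy : y₀ < 2 ^ s) :
    bitOverlap (x * 2 ^ s + x₀) (y * 2 ^ s + y₀) = bitOverlap x y + bitOverlap x₀ y₀ := by
  induction s generalizing x₀ y₀ with
  | zero => simp_all
  | succ s ih =>
    rw [pow_succ] at hx hy
    have e (z z₀ : ℕ) : (z * 2 ^ (s + 1) + z₀) / 2 = z * 2 ^ s + z₀ / 2 ∧
        (z * 2 ^ (s + 1) + z₀) % 2 = z₀ % 2 := by
      rw [pow_succ, ← mul_assoc]; omega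
    rw [bitOverlap_eq, (e x x₀).1, (e x x₀).2, (e y y₀).1, (e y y₀).2, ih (by omega) (by omega),
      bitOverlap_eq x₀ y₀, add_assoc]

lemma sigma_two_pow_mul_add (s x : ℕ) {x₀ : ℕ} (hx : x₀ < 2 ^ s) :
    sigma (x * 2 ^ s + x₀) = sigma x + sigma x₀ := by
  simp only [sigma_eq_bitOverlap, bitOverlap_two_pow_mul_add s x x hx hx]

@[simp] lemma sigma_zero : sigma 0 = 0 := by simp [sigma]

@[simp] lemma sigma_one : sigma 1 = 1 := by simp [sigma]

lemma sigma_two_pow (s : ℕ) : sigma (2 ^ s) = 1 := by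
  simpa using sigma_two_pow_mul_add s 1 (x₀ := 0) (by positivity)

lemma sigma_pos {n : ℕ} (hn : 0 < n) : 0 < sigma n := by
  induction n using Nat.strong_induction_on with
  | _ n ih =>
    rw [sigma_eq]
    rcases Nat.mod_two_eq_zero_or_one n with h | h
    · have := ih (n / 2) (by omega) (by omega)
      omega
    · omega

lemma bitOverlap_compl {s x : ℕ} (hx : x < 2 ^ s) : bitOverlap x (2 ^ s - 1 - x) = 0 := by
  induction s generalizing x with
  | zero => simp
  | succ s ih =>
    rw [pow_succ] at hx
    rw [bitOverlap_eq, pow_succ, show (2 ^ s * 2 - 1 - x) / 2 = 2 ^ s - 1 - x / 2 by omega,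
      ih (by omega)]
    rcases Nat.mod_two_eq_zero_or_one x with h | h
    · simp [h]
    · simp [show (2 ^ s * 2 - 1 - x) % 2 = 0 by omega]

lemma sigma_add_sigma_compl {s x : ℕ} (hx : x < 2 ^ s) : sigma x + sigma (2 ^ s - 1 - x) = s := by
  induction s generalizing x with
  | zero => simp_all
  | succ s ih =>
    rw [pow_succ] at hx
    have := ih (x := x / 2) (by omega)
    rw [sigma_eq x, sigma_eq (2 ^ (s + 1) - 1 - x), pow_succ,
      show (2 ^ s * 2 - 1 - x) / 2 = 2 ^ s - 1 - x / 2 by omega]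
    omega

/-- Negation modulo `2^s` keeps the lowest digit `1` and complements everything above it. -/
lemma bitOverlap_two_pow_sub {s x : ℕ} (h0 : 0 < x) (hx : x < 2 ^ s) :
    bitOverlap x (2 ^ s - x) = 1 := by
  induction s generalizing x with
  | zero => simp at hx; omega
  | succ s ih =>
    rw [pow_succ] at hx
    rw [bitOverlap_eq, pow_succ]
    rcases Nat.mod_two_eq_zero_or_one x with h | h
    · rw [show (2 ^ s * 2 - x) / 2 = 2 ^ s - x / 2 by omega, ih (by omega) (by omega), h]
      simp
    · rw [show (2 ^ s * 2 - x) / 2 = 2 ^ s - 1 - x / 2 by omega, bitOverlap_compl (by omega), h,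
        show (2 ^ s * 2 - x) % 2 = 1 by omega]

lemma bitOverlap_sub_one_of_odd {c : ℕ} (hc : Odd c) : bitOverlap c (c - 1) + 1 = sigma c := by
  obtain ⟨d, rfl⟩ := hc
  rw [bitOverlap_eq, sigma_eq, sigma_eq_bitOverlap, show (2 * d + 1) / 2 = d by omega,
    show (2 * d + 1 - 1) / 2 = d by omega, show (2 * d + 1 - 1) % 2 = 0 by omega,
    show (2 * d + 1) % 2 = 1 by omega]

/-- For `a ≤ 2^h` nothing is borrowed from the upper block, and the common digit comes from `b` and
`2^M - b`. Otherwise a borrow turns `2^M - b` into the complement of `b`, and the common digit is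
`2^h`. -/
lemma bitOverlap_low {b M h a : ℕ} (hb : 0 < b) (hbM : b < 2 ^ M) (ha : 0 < a)
    (ha' : a < 2 ^ (h + 1)) :
    bitOverlap (b * 2 ^ (h + 1) + 2 ^ h) ((2 ^ M - b) * 2 ^ (h + 1) + 2 ^ h - a) = 1 := by
  have h2 : 2 ^ (h + 1) = 2 * 2 ^ h := pow_succ' 2 h
  have hp : 0 < 2 ^ h := by positivity
  rcases le_or_gt a (2 ^ h) with hle | hlt
  · rw [Nat.add_sub_assoc hle, bitOverlap_two_pow_mul_add _ _ _ (by omega) (by omega),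
      bitOverlap_two_pow_sub hb hbM]
    have := bitOverlap_two_pow_mul_add h 1 0 (x₀ := 0) (y₀ := 2 ^ h - a) hp (by omega)
    simp at this
    simp [this]
  · have e : (2 ^ M - b) * 2 ^ (h + 1) + 2 ^ h - a
        = (2 ^ M - 1 - b) * 2 ^ (h + 1) + (1 * 2 ^ h + (2 ^ (h + 1) - a)) := by
      rw [show 2 ^ M - b = (2 ^ M - 1 - b) + 1 by omega, add_mul]
      omega
    rw [e, bitOverlap_two_pow_mul_add _ _ _ (by omega) (by omega), bitOverlap_compl hbM]
    have := bitOverlap_two_pow_mul_add h 1 1 (x₀ := 0) (y₀ := 2 ^ (h + 1) - a) hp (by omega)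
    simp only [one_mul, add_zero, bitOverlap_zero_left] at this ⊢
    rw [this, ← sigma_eq_bitOverlap, sigma_one]

/-! ### Binomial coefficients: Lucas and Legendre -/

/-- Lucas' theorem with the binary expansion cut at position `s`. -/
lemma choose_modEq_two_pow (s n k : ℕ) :
    n.choose k ≡ (n % 2 ^ s).choose (k % 2 ^ s) * (n / 2 ^ s).choose (k / 2 ^ s) [MOD 2] := by
  have : Fact (Nat.Prime 2) := ⟨Nat.prime_two⟩
  induction s generalizing n k with
  | zero => simp [Nat.mod_one, Nat.ModEq.refl]
  | succ s ih =>
    have h1 := ih (n % 2 ^ (s + 1)) (k % 2 ^ (s + 1))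
    have e (x : ℕ) : x % 2 ^ (s + 1) / 2 ^ s = x / 2 ^ s % 2 := by
      rw [pow_succ, Nat.mod_mul_right_div_self]
    rw [Nat.mod_mod_of_dvd _ (pow_dvd_pow 2 s.le_succ),
      Nat.mod_mod_of_dvd _ (pow_dvd_pow 2 s.le_succ), e, e] at h1
    have h2 := Choose.choose_modEq_choose_mod_mul_choose_div_nat (p := 2) (n := n / 2 ^ s)
      (k := k / 2 ^ s)
    rw [Nat.div_div_eq_div_mul, Nat.div_div_eq_div_mul, ← pow_succ] at h2
    refine (ih n k).trans (((Nat.ModEq.refl _).mul h2).trans ?_)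
    rw [← mul_assoc]
    exact h1.symm.mul_right _

lemma odd_choose_two_pow_sub_one {s x : ℕ} (hx : x < 2 ^ s) : Odd ((2 ^ s - 1).choose x) := by
  induction x with
  | zero => simp
  | succ x ih =>
    have h1 := ih (by omega)
    have h2 : Even ((2 ^ s).choose (x + 1)) :=
      even_iff_two_dvd.2 (Nat.prime_two.dvd_choose_pow (by omega) (by omega))
    have h3 := Nat.choose_succ_succ (2 ^ s - 1) x
    rw [Nat.succ_eq_add_one, Nat.sub_add_cancel (by omega)] at h3
    rw [h3, Nat.even_add] at h2
    rw [← Nat.not_even_iff_odd] at h1 ⊢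
    tauto

lemma odd_choose_mul_two_pow_sub_one {c s x : ℕ} (hc : 0 < c) (hx : x < 2 ^ s) :
    Odd ((c * 2 ^ s - 1).choose x) := by
  have h := choose_modEq_two_pow s (c * 2 ^ s - 1) x
  have e : c * 2 ^ s - 1 = (2 ^ s - 1) + 2 ^ s * (c - 1) := by
    obtain ⟨d, rfl⟩ := Nat.exists_eq_add_of_le' hc
    have : 0 < 2 ^ s := by positivity
    rw [Nat.add_sub_cancel, add_mul, mul_comm (2 ^ s)]
    omega
  rw [Nat.mod_eq_of_lt hx, Nat.div_eq_of_lt hx, Nat.choose_zero_right, mul_one, e,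
    Nat.add_mul_mod_self_left, Nat.mod_eq_of_lt (by omega), ← e] at h
  rw [Nat.odd_iff, h, ← Nat.odd_iff]
  exact odd_choose_two_pow_sub_one hx

lemma even_choose_mul_two_pow_add {c s x y : ℕ} (hxy : x < y) (hy : y < 2 ^ s) :
    2 ∣ (c * 2 ^ s + x).choose y := by
  have h := choose_modEq_two_pow s (c * 2 ^ s + x) y
  rw [Nat.mod_eq_of_lt hy, Nat.mul_add_mod_of_lt (hxy.trans hy), Nat.choose_eq_zero_of_lt hxy,
    zero_mul] at h
  exact (Nat.modEq_zero_iff_dvd).1 h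

lemma sigma_succ (n : ℕ) : sigma (n + 1) + padicValNat 2 (n + 1) = sigma n + 1 := by
  have : Fact (Nat.Prime 2) := ⟨Nat.prime_two⟩
  have h1 := sub_one_mul_padicValNat_factorial (p := 2) n
  have h2 := sub_one_mul_padicValNat_factorial (p := 2) (n + 1)
  have h3 := Nat.digit_sum_le 2 n
  have h4 := Nat.digit_sum_le 2 (n + 1)
  rw [Nat.factorial_succ, padicValNat.mul (by omega) (Nat.factorial_ne_zero n)] at h2
  simp only [sigma]
  omega

/-- Legendre's formula `ν(n!) = n - σ(n)` applied to the three factorials. -/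
lemma two_pow_sigma_add_sigma_dvd {i N : ℕ} (hi : i ≤ N) :
    2 ^ (sigma i + sigma (N - i)) ∣ 2 ^ sigma N * N.choose i := by
  have : Fact (Nat.Prime 2) := ⟨Nat.prime_two⟩
  have h1 (n : ℕ) : padicValNat 2 n.factorial + sigma n = n := by
    have h1 := sub_one_mul_padicValNat_factorial (p := 2) n
    have h3 := Nat.digit_sum_le 2 n
    simp only [sigma]
    omega
  have h2 := congrArg (padicValNat 2) (Nat.choose_mul_factorial_mul_factorial hi)
  have hc := (Nat.choose_pos hi).ne'
  rw [padicValNat.mul (by positivity) (by positivity),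
    padicValNat.mul hc (by positivity)] at h2
  rw [padicValNat_dvd_iff_le (by positivity), padicValNat.mul (by positivity) hc,
    padicValNat.prime_pow]
  have := h1 i
  have := h1 (N - i)
  have := h1 N
  omega

/-! ### Generating functions of the Stirling numbers -/

open PowerSeries

/-- The generating function `∑ᵢ S(i + k, k) Xⁱ`. -/
noncomputable def stirlingSeries (k : ℕ) : ℤ⟦X⟧ := mk fun i => (Nat.stirlingSecond (i + k) k : ℤ)

/-- The product `∏ⱼ (1 - j X)` over `1 ≤ j ≤ k`. -/
noncomputable def fallingProd (k : ℕ) : ℤ⟦X⟧ := ∏ j ∈ Finset.range k, (1 - ((j + 1 : ℕ) : ℤ⟦X⟧) * X)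

/-- The product `∏ⱼ (1 + j X)` over `0 ≤ j < A`. -/
noncomputable def risingProd (A : ℕ) : ℤ⟦X⟧ := ∏ j ∈ Finset.range A, (1 + (j : ℤ⟦X⟧) * X)

lemma coeff_natCast_mul (c n : ℕ) (f : ℤ⟦X⟧) : coeff n ((c : ℤ⟦X⟧) * f) = c * coeff n f := by
  rw [← map_natCast (C (R := ℤ)), coeff_C_mul]

lemma stirlingSeries_succ_mul (k : ℕ) :
    stirlingSeries (k + 1) * (1 - ((k + 1 : ℕ) : ℤ⟦X⟧) * X) = stirlingSeries k := by
  rw [mul_sub, mul_one, mul_left_comm]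
  ext n
  rw [map_sub, coeff_natCast_mul]
  cases n with
  | zero => simp [stirlingSeries, Nat.stirlingSecond_self]
  | succ n =>
    rw [coeff_succ_mul_X]
    simp only [stirlingSeries, coeff_mk]
    rw [show n + 1 + (k + 1) = (n + (k + 1)) + 1 by omega, Nat.stirlingSecond_succ_succ,
      show n + 1 + k = n + (k + 1) by omega]
    push_cast
    ring

lemma stirlingSeries_mul_fallingProd (k : ℕ) : stirlingSeries k * fallingProd k = 1 := by
  induction k with
  | zero =>
    rw [fallingProd, Finset.prod_range_zero, mul_one]
    ext n
    cases n <;> simp [stirlingSeries, coeff_one]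
  | succ k ih =>
    rw [fallingProd, Finset.prod_range_succ, mul_comm (∏ j ∈ _, _), ← mul_assoc,
      stirlingSeries_succ_mul]
    exact ih

lemma coeff_risingProd (A i : ℕ) :
    coeff i (risingProd A) = if i ≤ A then (Nat.stirlingFirst A (A - i) : ℤ) else 0 := by
  induction A generalizing i with
  | zero => cases i <;> simp [risingProd, coeff_one]
  | succ A ih =>
    rw [risingProd, Finset.prod_range_succ, ← risingProd, mul_add, mul_one, mul_left_comm, map_add,
      coeff_natCast_mul, ih]
    cases i with
    | zero =>
      simp [Nat.stirlingFirst_self]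
    | succ i =>
      rw [coeff_succ_mul_X, ih]
      rcases lt_trichotomy i A with h | rfl | h
      · rw [if_pos (by omega), if_pos (by omega), if_pos (by omega),
          show A + 1 - (i + 1) = (A - (i + 1)) + 1 by omega, Nat.stirlingFirst_succ_succ,
          show A - i = (A - (i + 1)) + 1 by omega]
        push_cast
        ring
      · cases i <;> simp
      · rw [if_neg (by omega), if_neg (by omega), if_neg (by omega)]
        simp

/-! ### Products of consecutive factors modulo powers of two -/

lemma two_pow_dvd_coeff {e : ℕ} {f : ℤ⟦X⟧} (h : (2 : ℤ⟦X⟧) ^ e ∣ f) (n : ℕ) :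
    2 ^ e ∣ coeff n f := by
  obtain ⟨g, rfl⟩ := h
  rw [← map_ofNat (C (R := ℤ)), ← map_pow, coeff_C_mul]
  exact dvd_mul_right _ _

lemma dvd_prod_sub_prod {R ι : Type*} [CommRing R] (s : Finset ι) {f g : ι → R} {d : R}
    (h : ∀ i ∈ s, d ∣ f i - g i) : d ∣ ∏ i ∈ s, f i - ∏ i ∈ s, g i := by
  classical
  induction s using Finset.induction_on with
  | empty => simp
  | insert a s ha ih =>
    rw [Finset.prod_insert ha, Finset.prod_insert ha]
    have h1 := h a (Finset.mem_insert_self a s)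
    have h2 := ih fun i hi => h i (Finset.mem_insert_of_mem hi)
    convert (h1.mul_right (∏ i ∈ s, f i)).add (h2.mul_left (g a)) using 1
    ring

/-- The product of the four factors `1 - j X` for `j = v + 1, …, v + 4`. -/
noncomputable def fourFactors (v : ℤ⟦X⟧) : ℤ⟦X⟧ :=
  (1 - (v + 1) * X) * (1 - (v + 2) * X) * (1 - (v + 3) * X) * (1 - (v + 4) * X)

/-- Pairing the factors at distance 2 gives `(1 - (v+2)X)² - X²` and `(1 - (v+3)X)² - X²`. Squares
gain one factor 2 over the shift `2w`. -/
lemma dvd_fourFactors_add_sub (v w : ℤ⟦X⟧) :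
    2 * (2 * w) ∣ fourFactors (v + 2 * w) - fourFactors v := by
  have key (p₁ p₂ d₁ d₂ T : ℤ⟦X⟧) :
      (p₁ + 2 * T * d₁) * (p₂ + 2 * T * d₂) - p₁ * p₂
        = 2 * T * (d₁ * p₂ + p₁ * d₂ + 2 * T * d₁ * d₂) := by ring
  refine Dvd.intro _ (Eq.trans (key ((1 - (v + 2) * X) ^ 2 - X ^ 2) ((1 - (v + 3) * X) ^ 2 - X ^ 2)
    (-(1 - (v + 2) * X) * X + w * X ^ 2) (-(1 - (v + 3) * X) * X + w * X ^ 2) (2 * w)).symm ?_)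
  simp only [fourFactors]
  ring

lemma fallingProd_four_mul (M : ℕ) :
    fallingProd (4 * M) = ∏ q ∈ Finset.range M, fourFactors ((4 * q : ℕ) : ℤ⟦X⟧) := by
  induction M with
  | zero => simp [fallingProd]
  | succ M ih =>
    rw [Finset.prod_range_succ, ← ih, fallingProd, show 4 * (M + 1) = 4 * M + 1 + 1 + 1 + 1 by ring,
      Finset.prod_range_succ, Finset.prod_range_succ, Finset.prod_range_succ,
      Finset.prod_range_succ, ← fallingProd, fourFactors]
    push_cast
    ring

/-- Successive blocks of `4 * 2^t` factors are shifts of the first block by multiples of `2^(t+2)`;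
the extra factor 2 gives the modulus `2^(t+3)`. -/
lemma dvd_fallingProd_sub_pow (t M : ℕ) :
    (2 : ℤ⟦X⟧) ^ (t + 3) ∣ fallingProd (4 * (M * 2 ^ t)) - fallingProd (4 * 2 ^ t) ^ M := by
  induction M with
  | zero => simp [fallingProd]
  | succ M ih =>
    have h : (2 : ℤ⟦X⟧) ^ (t + 3) ∣
        ∏ q ∈ Finset.range (2 ^ t), fourFactors ((4 * (M * 2 ^ t + q) : ℕ) : ℤ⟦X⟧)
          - fallingProd (4 * 2 ^ t) := by
      rw [fallingProd_four_mul]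
      refine dvd_prod_sub_prod _ fun q _ => ?_
      have h1 := dvd_fourFactors_add_sub ((4 * q : ℕ) : ℤ⟦X⟧) (2 ^ (t + 1) * M)
      have e : ((4 * q : ℕ) : ℤ⟦X⟧) + 2 * (2 ^ (t + 1) * M) = ((4 * (M * 2 ^ t + q) : ℕ) : ℤ⟦X⟧) := by
        push_cast
        ring
      rw [e] at h1
      refine (Dvd.intro (M : ℤ⟦X⟧) ?_).trans h1
      ring
    rw [add_mul, one_mul, fallingProd_four_mul, Finset.prod_range_add, ← fallingProd_four_mul]
    convert (ih.mul_right (∏ q ∈ Finset.range (2 ^ t),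
      fourFactors ((4 * (M * 2 ^ t + q) : ℕ) : ℤ⟦X⟧))).add (h.mul_left (fallingProd (4 * 2 ^ t) ^ M)) using 1
    ring

lemma dvd_fallingProd_succ {t : ℕ} {U : ℤ⟦X⟧}
    (h : (2 : ℤ⟦X⟧) ^ (t + 2) ∣ fallingProd (4 * 2 ^ t) - U) :
    (2 : ℤ⟦X⟧) ^ (t + 3) ∣ fallingProd (4 * 2 ^ (t + 1)) - U ^ 2 := by
  have h1 := dvd_fallingProd_sub_pow t 2
  rw [← pow_succ'] at h1
  obtain ⟨g, hg⟩ := h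
  have h2 : (2 : ℤ⟦X⟧) ^ (t + 3) ∣ fallingProd (4 * 2 ^ t) ^ 2 - U ^ 2 := by
    rw [eq_add_of_sub_eq hg]
    exact Dvd.intro (g * (2 ^ (t + 1) * g + U)) (by ring)
  convert h1.add h2 using 1
  ring

lemma exists_fallingProd_congr (t : ℕ) : ∃ e : ℤ, (2 : ℤ⟦X⟧) ^ (t + 2) ∣
    fallingProd (4 * 2 ^ t) - (1 - X ^ 2) ^ 2 ^ t * (1 + 2 ^ (t + 1) * (X + C e * X ^ 2)) := by
  have h0 : (2 : ℤ⟦X⟧) ^ (0 + 2) ∣ fallingProd (4 * 2 ^ 0) - (1 - X ^ 2) * (1 + 2 * X) := by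
    refine Dvd.intro (-3 * X + 9 * X ^ 2 - 12 * X ^ 3 + 6 * X ^ 4) ?_
    rw [pow_zero, fallingProd_four_mul, Finset.prod_range_one, fourFactors]
    push_cast
    ring
  rcases Nat.eq_zero_or_pos t with rfl | ht
  · exact ⟨0, by simpa using h0⟩
  -- Squaring `1 + 2X` gives `1 + 4(X + X²)`, hence `e = 1`. Later squarings keep `e`, as the square
  -- of the correction is then 0 to the required precision.
  · refine ⟨1, ?_⟩
    induction t, ht using Nat.le_induction with
    | base =>
      have h1 := dvd_fallingProd_succ h0
      convert h1 using 2
      rw [map_one]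
      ring
    | succ t ht ih =>
      have h1 := dvd_fallingProd_succ ih
      obtain ⟨s, rfl⟩ := Nat.exists_eq_add_of_le' ht
      have h2 : (2 : ℤ⟦X⟧) ^ (s + 1 + 3) ∣
          ((1 - X ^ 2) ^ 2 ^ (s + 1) * (1 + 2 ^ (s + 1 + 1) * (X + C 1 * X ^ 2))) ^ 2
          - (1 - X ^ 2) ^ 2 ^ (s + 1 + 1) * (1 + 2 ^ (s + 1 + 1 + 1) * (X + C 1 * X ^ 2)) := by
        refine Dvd.intro ((1 - X ^ 2) ^ 2 ^ (s + 1 + 1) * (2 ^ s * (X + C 1 * X ^ 2) ^ 2)) ?_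
        rw [pow_succ 2 (s + 1), pow_mul (1 - X ^ 2 : ℤ⟦X⟧)]
        ring
      convert h1.add h2 using 1
      ring

/-- The power series `(1 - X²)⁻ᴮ`. -/
noncomputable def invOneSubSqPow (B : ℕ) : ℤ⟦X⟧ := expand 2 two_ne_zero (invOneSubPow ℤ B).val

lemma invOneSubSqPow_mul (B : ℕ) : invOneSubSqPow B * (1 - X ^ 2) ^ B = 1 := by
  have h : (invOneSubPow ℤ B).val * (1 - X) ^ B = 1 := by
    rw [← invOneSubPow_inv_eq_one_sub_pow]
    exact (invOneSubPow ℤ B).val_inv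
  have := congrArg (expand 2 two_ne_zero) h
  simpa [invOneSubSqPow] using this

lemma coeff_invOneSubSqPow_of_odd (B : ℕ) {n : ℕ} (hn : Odd n) :
    coeff n (invOneSubSqPow B) = 0 :=
  coeff_expand_of_not_dvd _ _ _ (by rwa [← even_iff_two_dvd, Nat.not_even_iff_odd])

lemma coeff_invOneSubSqPow_two_mul {B : ℕ} (hB : 0 < B) (J : ℕ) :
    coeff (2 * J) (invOneSubSqPow B) = ((B - 1 + J).choose (B - 1) : ℤ) := by
  rw [invOneSubSqPow, coeff_expand_mul, invOneSubPow_val_eq_mk_sub_one_add_choose_of_pos _ _ hB,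
    coeff_mk]

lemma exists_stirlingSeries_congr {a b t k A : ℕ} (hA : a + A = 2 ^ (t + 2))
    (hk : k = b * 2 ^ (t + 3) + a) : ∃ e : ℤ, (2 : ℤ⟦X⟧) ^ (t + 2) ∣ stirlingSeries k -
      risingProd A * (invOneSubSqPow (2 ^ t * (2 * b + 1)) *
        (1 - 2 ^ (t + 1) * (X + C e * X ^ 2))) := by
  obtain ⟨e, he⟩ := exists_fallingProd_congr t
  refine ⟨e, ?_⟩
  set R : ℤ⟦X⟧ := X + C e * X ^ 2
  set B := 2 ^ t * (2 * b + 1) with hB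
  set K := 4 * ((2 * b + 1) * 2 ^ t) with hK
  have hkA : K = k + A := by
    rw [hK, hk, add_assoc, hA]
    ring
  set tail : ℤ⟦X⟧ := ∏ j ∈ Finset.range A, (1 - ((k + j + 1 : ℕ) : ℤ⟦X⟧) * X)
  have hfull : fallingProd K = fallingProd k * tail := by
    rw [hkA, fallingProd, Finset.prod_range_add, ← fallingProd]
  have hW : stirlingSeries k * fallingProd K = tail := by
    rw [hfull, ← mul_assoc, stirlingSeries_mul_fallingProd, one_mul]
  have htail : (2 : ℤ⟦X⟧) ^ (t + 2) ∣ tail - risingProd A := by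
    -- Reversal pairs `k+j+1` with `A-1-j`, whose sum `4B` is divisible by `2^(t+2)`.
    rw [risingProd, ← Finset.prod_range_reflect]
    refine dvd_prod_sub_prod _ fun j hj => ?_
    have hj' := Finset.mem_range.1 hj
    have h1 : ((k + j + 1 : ℕ) : ℤ⟦X⟧) + (A - 1 - j : ℕ) = 2 ^ (t + 2) * (2 * b + 1) := by
      rw [← Nat.cast_add, show k + j + 1 + (A - 1 - j) = K by omega, hK]
      push_cast
      ring
    refine Dvd.intro (-(2 * (b : ℤ⟦X⟧) + 1) * X) ?_
    linear_combination X * h1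
  have hfc : (2 : ℤ⟦X⟧) ^ (t + 2) ∣ fallingProd K - (1 - X ^ 2) ^ B * (1 + 2 ^ (t + 1) * R) := by
    have h1 := (pow_dvd_pow (2 : ℤ⟦X⟧) (by omega : t + 2 ≤ t + 3)).trans
      (dvd_fallingProd_sub_pow t (2 * b + 1))
    have h2 := he.trans (sub_dvd_pow_sub_pow _ _ (2 * b + 1))
    -- Of the exponent `2b+1` only the parity matters.
    have h3 : (2 : ℤ⟦X⟧) ^ (t + 2) ∣ (1 + 2 ^ (t + 1) * R) ^ (2 * b) - 1 := by
      have h4 : (2 : ℤ⟦X⟧) ^ (t + 2) ∣ (1 + 2 ^ (t + 1) * R) ^ 2 - 1 :=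
        Dvd.intro (R + 2 ^ t * R ^ 2) (by ring)
      have h5 := sub_dvd_pow_sub_pow ((1 + 2 ^ (t + 1) * R) ^ 2) 1 b
      rw [one_pow, ← pow_mul] at h5
      exact h4.trans h5
    rw [mul_pow, ← pow_mul, ← hB, pow_succ (1 + 2 ^ (t + 1) * R)] at h2
    convert (h1.add h2).add (h3.mul_left ((1 - X ^ 2) ^ B * (1 + 2 ^ (t + 1) * R))) using 1
    ring
  have hH := invOneSubSqPow_mul B
  -- The error in taking `1 - y` as inverse of `1 + y` is `y²`, here with `y = 2^(t+1) R`.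
  have h6 : (2 : ℤ⟦X⟧) ^ (t + 2) ∣ stirlingSeries k * (2 ^ (2 * t + 2) * R ^ 2) :=
    Dvd.intro (stirlingSeries k * (2 ^ t * R ^ 2)) (by ring)
  convert ((htail.sub (hfc.mul_left (stirlingSeries k))).mul_right
    (invOneSubSqPow B * (1 - 2 ^ (t + 1) * R))).add h6 using 1
  linear_combination (-(stirlingSeries k * (1 - (2 ^ (t + 1) * R) ^ 2))) * hH +
    invOneSubSqPow B * (1 - 2 ^ (t + 1) * R) * hW

/-! ### Divisibility of Stirling numbers of the first kind -/

/-- Marking a cycle among `r + 1`, other than the one of a fixed element: sum over its size `i + 1`. -/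
lemma mul_stirlingFirst_eq_sum (N r : ℕ) :
    r * Nat.stirlingFirst (N + 1) (r + 1) = ∑ i ∈ Finset.range N,
      N.choose (i + 1) * i.factorial * Nat.stirlingFirst (N - i) r := by
  induction N generalizing r with
  | zero => cases r <;> simp [Nat.stirlingFirst]
  | succ N ih =>
    cases r with
    | zero =>
      rw [zero_mul, eq_comm]
      refine Finset.sum_eq_zero fun i hi => ?_
      rw [show N + 1 - i = (N - i) + 1 by have := Finset.mem_range.1 hi; omega]
      simp
    | succ r =>
      have h1 : ∑ i ∈ Finset.range (N + 1),
          (N + 1).choose (i + 1) * i.factorial * Nat.stirlingFirst (N + 1 - i) (r + 1)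
          = ∑ i ∈ Finset.range (N + 1),
              N.choose i * i.factorial * Nat.stirlingFirst (N + 1 - i) (r + 1)
            + ∑ i ∈ Finset.range (N + 1),
              N.choose (i + 1) * i.factorial * Nat.stirlingFirst (N + 1 - i) (r + 1) := by
        rw [← Finset.sum_add_distrib]
        refine Finset.sum_congr rfl fun i _ => ?_
        rw [Nat.choose_succ_succ]
        ring
      have h2 : (N + 1) * ((r + 1) * Nat.stirlingFirst (N + 1) (r + 1 + 1))
          + r * Nat.stirlingFirst (N + 1) (r + 1)
          = ∑ i ∈ Finset.range N,
              N.choose (i + 1) * (i + 1).factorial * Nat.stirlingFirst (N - i) (r + 1)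
            + ∑ i ∈ Finset.range N,
              N.choose (i + 1) * i.factorial * Nat.stirlingFirst (N + 1 - i) (r + 1) := by
        rw [ih, ih, Finset.mul_sum, ← Finset.sum_add_distrib, ← Finset.sum_add_distrib]
        refine Finset.sum_congr rfl fun i hi => ?_
        obtain ⟨j, rfl⟩ := Nat.exists_eq_add_of_lt (Finset.mem_range.1 hi)
        rw [show i + j + 1 + 1 - i = (j + 1) + 1 by omega, show i + j + 1 - i = j + 1 by omega,
          Nat.stirlingFirst_succ_succ (j + 1), Nat.factorial_succ]
        ring
      rw [h1, Finset.sum_range_succ', Finset.sum_range_succ _ N, Nat.choose_succ_self]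
      simp only [Nat.choose_zero_right, Nat.factorial_zero, Nat.sub_zero, Nat.add_sub_add_right]
      rw [Nat.stirlingFirst_succ_succ (N + 1)]
      linear_combination h2

/-- Induction on `r` through the marked-cycle identity: in each term the binomial trades `σ(N)` for
`σ(i+1) + σ(N-i-1)`; the second part feeds the induction hypothesis and the first supplies a further
2. Dividing by `r+1` is paid for by `sigma_succ`. -/
lemma two_pow_sigma_dvd_stirlingFirst (r N : ℕ) :
    2 ^ sigma r ∣ 2 ^ sigma N * Nat.stirlingFirst (N + 1) (r + 1) := by
  have : Fact (Nat.Prime 2) := ⟨Nat.prime_two⟩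
  induction r generalizing N with
  | zero => simp
  | succ r ih =>
    have h1 : 2 ^ (sigma r + 1) ∣
        (r + 1) * (2 ^ sigma N * Nat.stirlingFirst (N + 1) (r + 1 + 1)) := by
      rw [mul_left_comm, mul_stirlingFirst_eq_sum, Finset.mul_sum]
      refine Finset.dvd_sum fun i hi => ?_
      have hi' : i + 1 ≤ N := Finset.mem_range.1 hi
      obtain ⟨q, hq⟩ := two_pow_sigma_add_sigma_dvd hi'
      have h2 := ih (N - (i + 1))
      rw [show N - (i + 1) + 1 = N - i by omega] at h2
      have h3 : 2 ∣ 2 ^ sigma (i + 1) := dvd_pow_self 2 (sigma_pos i.succ_pos).ne'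
      rw [← mul_assoc, ← mul_assoc, hq, pow_add, pow_succ]
      refine (mul_dvd_mul h2 h3).trans (Dvd.intro (q * i.factorial) ?_)
      ring
    rw [← sigma_succ, pow_add] at h1
    obtain ⟨v, hv⟩ : ∃ v, r + 1 = 2 ^ padicValNat 2 (r + 1) * v := pow_padicValNat_dvd
    have hodd : ¬ 2 ∣ v := by
      rintro ⟨w, rfl⟩
      refine pow_succ_padicValNat_not_dvd (p := 2) (n := r + 1) (by omega) ⟨w, ?_⟩
      rw [pow_succ]
      linarith
    have h4 : 2 ^ sigma (r + 1) ∣ v * (2 ^ sigma N * Nat.stirlingFirst (N + 1) (r + 1 + 1)) := by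
      refine Nat.dvd_of_mul_dvd_mul_left (k := 2 ^ padicValNat 2 (r + 1)) (by positivity) ?_
      rw [← mul_assoc, ← hv, mul_comm]
      exact h1
    exact (Nat.Coprime.pow_left _ ((Nat.Prime.coprime_iff_not_dvd Nat.prime_two).2 hodd)).dvd_of_dvd_mul_left h4

/-! ### The valuation of `S(n,k)` in the two cases -/

/-- With `j = 2w` and `p = ν(w)`, absorption `(B+J) C(B+J-1,B-1) = C(B+J,B) B` gives the binomial
valuation at least `t+1-p`: `C(B+J,B)` is even, and `ν(B+J) = p`. As `σ(j-1) ≥ p+1`, `s(A,j)` has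
valuation at least `p+1-σ(A-1)`, and `σ(A-1) = t+2-σ(a)`. -/
lemma two_pow_dvd_stirlingFirst_mul_choose {a A b c t s j J : ℕ} (hA : a + A = 2 ^ (t + 2))
    (hb : 0 < b) (hB : 2 ^ t * (2 * b + 1) < 2 ^ s) (hj : 0 < j) (hjA : j ≤ A) (ha : 0 < a)
    (hJ : 2 * (2 ^ t * (2 * b + 1) + J) = c * 2 ^ (s + 1) + j) :
    2 ^ sigma a ∣ Nat.stirlingFirst A j *
      (2 ^ t * (2 * b + 1) - 1 + J).choose (2 ^ t * (2 * b + 1) - 1) := by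
  have : Fact (Nat.Prime 2) := ⟨Nat.prime_two⟩
  set B := 2 ^ t * (2 * b + 1) with hBdef
  have hB0 : 0 < B := by positivity
  obtain ⟨w, rfl⟩ : 2 ∣ j := by
    have h1 : 2 ∣ c * 2 ^ (s + 1) := Dvd.intro (c * 2 ^ s) (by ring)
    exact (Nat.dvd_add_right h1).1 (hJ ▸ Dvd.intro _ rfl)
  have hBJ : B + J = c * 2 ^ s + w := by rw [pow_succ] at hJ; linarith
  -- Here `2w ≤ A < 2^(t+2)`, while `B ≥ 3 * 2^t`.
  have hw : w < B := by
    have h1 : 2 ^ t * 1 ≤ 2 ^ t * b := Nat.mul_le_mul_left _ hb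
    have h2 : 2 ^ (t + 2) = 4 * 2 ^ t := by ring
    have h3 : B = 2 * (2 ^ t * b) + 2 ^ t := by rw [hBdef]; ring
    omega
  obtain ⟨p, v, hv, rfl⟩ := Nat.exists_eq_two_pow_mul_odd (n := w) (by omega)
  have hp : p < s := by
    have h1 : 2 ^ p * 1 ≤ 2 ^ p * v := Nat.mul_le_mul_left _ hv.pos
    exact (Nat.pow_lt_pow_iff_right (by norm_num)).1 (by omega : 2 ^ p < 2 ^ s)
  obtain ⟨q, rfl⟩ := Nat.exists_eq_add_of_lt hp
  have h1 := Nat.add_one_mul_choose_eq (B - 1 + J) (B - 1)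
  rw [show B - 1 + J + 1 = B + J by omega, show B - 1 + 1 = B by omega] at h1
  have h2 : 2 ^ (t + 1) ∣ (B + J) * (B - 1 + J).choose (B - 1) := by
    rw [h1, hBJ, pow_succ']
    exact mul_dvd_mul (even_choose_mul_two_pow_add hw hB) (Dvd.intro _ hBdef.symm)
  have h3 : 2 ^ (t + 1) ∣ 2 ^ p * (B - 1 + J).choose (B - 1) := by
    have hodd : Odd (c * 2 ^ (q + 1) + v) :=
      Even.add_odd (even_iff_two_dvd.2 (Dvd.intro (c * 2 ^ q) (by ring))) hv
    refine (Nat.Coprime.pow_left _ (Nat.coprime_two_left.2 hodd)).dvd_of_dvd_mul_left ?_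
    convert h2 using 1
    rw [hBJ]
    ring
  have h4 : 2 ^ (p + 1) ∣ 2 ^ sigma (A - 1) * Nat.stirlingFirst A (2 * (2 ^ p * v)) := by
    have h5 := two_pow_sigma_dvd_stirlingFirst (2 * (2 ^ p * v) - 1) (A - 1)
    have h6 := sigma_succ (2 * (2 ^ p * v) - 1)
    rw [Nat.sub_add_cancel hj] at h6
    rw [Nat.sub_add_cancel hj, Nat.sub_add_cancel (by omega)] at h5
    have h7 : p + 1 ≤ padicValNat 2 (2 * (2 ^ p * v)) :=
      (padicValNat_dvd_iff_le hj.ne').1 (Dvd.intro v (by ring))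
    have h8 := sigma_pos hj
    exact (pow_dvd_pow 2 (by omega)).trans h5
  have h9 := sigma_add_sigma_compl (s := t + 2) (x := a) (by omega)
  rw [show 2 ^ (t + 2) - 1 - a = A - 1 by omega] at h9
  refine Nat.dvd_of_mul_dvd_mul_left (k := 2 ^ sigma (A - 1)) (by positivity) ?_
  rw [← pow_add, add_comm (sigma (A - 1)), h9, ← mul_assoc]
  refine dvd_trans ?_ (mul_dvd_mul_right h4 _)
  rw [pow_succ' 2 (t + 1), pow_succ' 2 p, mul_assoc]
  exact mul_dvd_mul_left 2 h3

lemma two_pow_sigma_dvd_stirlingSecond {a A b c t s k N : ℕ} (hA : a + A = 2 ^ (t + 2))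
    (hb : 0 < b) (hB : 2 ^ t * (2 * b + 1) < 2 ^ s) (ha : 0 < a) (hA1 : 1 < A)
    (hk : k = b * 2 ^ (t + 3) + a)
    (hN : 2 * (2 ^ t * (2 * b + 1)) + N = c * 2 ^ (s + 1) + A) :
    2 ^ sigma a ∣ Nat.stirlingSecond (N + k) k := by
  obtain ⟨e, he⟩ := exists_stirlingSeries_congr hA hk
  set B := 2 ^ t * (2 * b + 1) with hBdef
  -- As `A > 1`, not all `t+2` digits of `a` are 1.
  have hσ : sigma a ≤ t + 1 := by
    have h9 := sigma_add_sigma_compl (s := t + 2) (x := a) (by omega)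
    have := sigma_pos (n := 2 ^ (t + 2) - 1 - a) (by omega)
    omega
  have h1 : (2 : ℤ⟦X⟧) ^ sigma a ∣ stirlingSeries k - risingProd A * invOneSubSqPow B := by
    have h2 : (2 : ℤ⟦X⟧) ^ sigma a ∣
        2 ^ (t + 1) * (risingProd A * invOneSubSqPow B * (X + C e * X ^ 2)) :=
      (pow_dvd_pow 2 hσ).mul_right _
    convert ((pow_dvd_pow (2 : ℤ⟦X⟧) (by omega : sigma a ≤ t + 2)).trans he).sub h2 using 1
    ring
  have h3 := two_pow_dvd_coeff h1 N
  have h4 : (2 : ℤ) ^ sigma a ∣ coeff N (risingProd A * invOneSubSqPow B) := by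
    rw [coeff_mul]
    refine Finset.dvd_sum fun x hx => ?_
    obtain ⟨i, l⟩ := x
    have hil : i + l = N := Finset.HasAntidiagonal.mem_antidiagonal.1 hx
    rw [coeff_risingProd]
    rcases Nat.even_or_odd l with hl | hl
    · obtain ⟨J, rfl⟩ := hl.two_dvd
      rw [coeff_invOneSubSqPow_two_mul (by positivity)]
      rcases lt_trichotomy i A with hi | rfl | hi
      · rw [if_pos hi.le]
        have h5 := two_pow_dvd_stirlingFirst_mul_choose (c := c) (j := A - i) (J := J) hA hb hB
          (by omega) (by omega) ha (by omega)
        exact_mod_cast h5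
      -- The term with `j = 0` vanishes because `s(A,0) = 0`.
      · rw [show i = (i - 1) + 1 by omega]
        simp
      · rw [if_neg (by omega)]
        simp
    · simp [coeff_invOneSubSqPow_of_odd B hl]
  rw [map_sub] at h3
  have h5 := (dvd_sub_left h4).1 h3
  rw [stirlingSeries, coeff_mk] at h5
  exact_mod_cast h5

lemma padicValNat_stirlingSecond_eq {b c t s k J : ℕ} (hc : 0 < c)
    (hB : 2 ^ t * (2 * b + 1) < 2 ^ s) (hk : k + 1 = b * 2 ^ (t + 3) + 2 ^ (t + 2))
    (hJ : 2 ^ t * (2 * b + 1) + J = c * 2 ^ s) :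
    padicValNat 2 (Nat.stirlingSecond (2 * J + 1 + k) k) = t + 1 := by
  have : Fact (Nat.Prime 2) := ⟨Nat.prime_two⟩
  have hp : 0 < 2 ^ (t + 2) := by positivity
  obtain ⟨e, he⟩ := exists_stirlingSeries_congr (a := 2 ^ (t + 2) - 1) (b := b) (t := t) (k := k)
    (A := 1) (by omega) (by omega)
  set B := 2 ^ t * (2 * b + 1) with hBdef
  have hB0 : 0 < B := by positivity
  have h1 := two_pow_dvd_coeff he (2 * J + 1)
  have h2 : coeff (2 * J + 1) (risingProd 1 * (invOneSubSqPow B *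
      (1 - 2 ^ (t + 1) * (X + C e * X ^ 2)))) = -(2 ^ (t + 1) * ((B - 1 + J).choose (B - 1) : ℤ)) := by
    have h3 : risingProd 1 * (invOneSubSqPow B * (1 - 2 ^ (t + 1) * (X + C e * X ^ 2)))
        = invOneSubSqPow B - C (2 ^ (t + 1)) * (invOneSubSqPow B * X)
          - C (2 ^ (t + 1) * e) * (invOneSubSqPow B * X * X) := by
      simp only [risingProd, Finset.prod_range_one, map_mul, map_pow, map_ofNat]
      push_cast
      ring
    have h4 : coeff (2 * J) (invOneSubSqPow B * X) = 0 := by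
      cases J with
      | zero => simp
      | succ J =>
        rw [show 2 * (J + 1) = 2 * J + 1 + 1 by ring, coeff_succ_mul_X,
          coeff_invOneSubSqPow_of_odd B ⟨J, rfl⟩]
    rw [h3, map_sub, map_sub, coeff_C_mul, coeff_C_mul, coeff_succ_mul_X, coeff_succ_mul_X, h4,
      coeff_invOneSubSqPow_of_odd B ⟨J, rfl⟩, coeff_invOneSubSqPow_two_mul hB0]
    ring
  rw [map_sub, h2, stirlingSeries, coeff_mk, sub_neg_eq_add] at h1
  have h1' : 2 ^ (t + 2) ∣ Nat.stirlingSecond (2 * J + 1 + k) k +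
      2 ^ (t + 1) * (B - 1 + J).choose (B - 1) := by exact_mod_cast h1
  -- The lowest `s` digits of `c * 2^s - 1` are all 1.
  have hodd : Odd ((B - 1 + J).choose (B - 1)) := by
    rw [show B - 1 + J = c * 2 ^ s - 1 by omega]
    exact odd_choose_mul_two_pow_sub_one hc (by omega)
  have h5 : 2 ^ (t + 1) ∣ Nat.stirlingSecond (2 * J + 1 + k) k :=
    (Nat.dvd_add_left (Dvd.intro _ rfl)).1 ((pow_dvd_pow 2 (Nat.le_succ (t + 1))).trans h1')
  have h6 : ¬ 2 ^ (t + 2) ∣ Nat.stirlingSecond (2 * J + 1 + k) k := fun h => by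
    have h7 := (Nat.dvd_add_right h).1 h1'
    rw [pow_succ 2 (t + 1)] at h7
    exact hodd.not_two_dvd_nat (Nat.dvd_of_mul_dvd_mul_left (by positivity) h7)
  have h0 : Nat.stirlingSecond (2 * J + 1 + k) k ≠ 0 := fun h => h6 (h ▸ dvd_zero _)
  rw [padicValNat_dvd_iff_le h0] at h5 h6
  omega

lemma stirlingSecond_pos {n k : ℕ} (hk : 0 < k) (hkn : k ≤ n) : 0 < Nat.stirlingSecond n k := by
  induction n, hkn using Nat.le_induction with
  | base => simp [Nat.stirlingSecond_self]
  | succ n _ ih =>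
    rw [Nat.stirlingSecond_succ_left n k hk.ne']
    positivity

/-! ### The two estimates for the given `n` and `k` -/

/-- The subtraction borrows one from `c`. The digits common to `c` and `c-1` number `σ(c) - 1` for
odd `c`, and the lower block adds one. -/
lemma card_twoPowers_inter_eq {a b c M h : ℕ} (ha : 0 < a) (hb : 0 < b) (hc : Odd c)
    (ha' : a < 2 ^ (h + 1)) (hbM : b < 2 ^ M) {n k : ℕ}
    (hn : n = c * 2 ^ (M + (h + 1)) + (b * 2 ^ (h + 1) + 2 ^ h))
    (hk : k = b * 2 ^ (h + 2) + a) (hlow : b * 2 ^ (h + 1) + 2 ^ h < 2 ^ (M + (h + 1))) :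
    (twoPowers n ∩ twoPowers (n - k)).card = sigma c := by
  have e2 : 2 ^ (h + 2) = 2 * 2 ^ (h + 1) := by ring
  have e1 : 2 ^ (h + 1) = 2 * 2 ^ h := by ring
  have hp : 0 < 2 ^ h := by positivity
  have hexp : (2 ^ M - b) * 2 ^ (h + 1) + b * 2 ^ (h + 1) = 2 ^ (M + (h + 1)) := by
    rw [← add_mul, Nat.sub_add_cancel hbM.le, ← pow_add]
  have hge : 1 * 2 ^ (h + 1) ≤ (2 ^ M - b) * 2 ^ (h + 1) := Nat.mul_le_mul_right _ (by omega)
  have hbge : 1 * 2 ^ (h + 1) ≤ b * 2 ^ (h + 1) := Nat.mul_le_mul_right _ hb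
  have hc1 : c * 2 ^ (M + (h + 1)) = (c - 1) * 2 ^ (M + (h + 1)) + 2 ^ (M + (h + 1)) := by
    rw [← Nat.succ_mul, Nat.succ_eq_add_one, Nat.sub_add_cancel hc.pos]
  have e3 : b * 2 ^ (h + 2) = 2 * (b * 2 ^ (h + 1)) := by ring
  have hsub : n - k
      = (c - 1) * 2 ^ (M + (h + 1)) + ((2 ^ M - b) * 2 ^ (h + 1) + 2 ^ h - a) := by
    rw [hn, hk, e3, hc1]
    omega
  rw [card_twoPowers_inter, hsub, hn, bitOverlap_two_pow_mul_add _ _ _ hlow (by omega),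
    bitOverlap_low hb hbM ha ha', bitOverlap_sub_one_of_odd hc]

lemma mzEstimate_eq {a b c m h : ℕ} (ha' : a < 2 ^ (h + 1)) {n k : ℕ}
    (hn : n = c * 2 ^ m + (b * 2 ^ (h + 1) + 2 ^ h)) (hk : k = b * 2 ^ (h + 2) + a)
    (hlow : b * 2 ^ (h + 1) + 2 ^ h < 2 ^ m) :
    mzEstimate n k = (sigma a : ℤ) - 1 - sigma c := by
  have e2 : 2 ^ (h + 2) = 2 * 2 ^ (h + 1) := by ring
  have e1 : 2 ^ (h + 1) = 2 * 2 ^ h := by ring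
  have hp : 0 < 2 ^ h := by positivity
  rw [mzEstimate, hn, hk, sigma_two_pow_mul_add _ _ hlow,
    sigma_two_pow_mul_add _ _ (by omega : 2 ^ h < 2 ^ (h + 1)),
    sigma_two_pow_mul_add _ _ (by omega : a < 2 ^ (h + 2)), sigma_two_pow]
  push_cast
  ring

end StirlingTwoAdic

theorem theorem2p3 (a b c m h : ℕ) (ha : 0 < a) (hb : 0 < b) (hm : 0 < m) (hh : 0 < h)
    (hc : Odd c) (ha' : a < 2 ^ (h + 1)) (hbm : b * 2 ^ (h + 1) + 2 ^ h < 2 ^ m)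
    (n k : ℕ) (hn : n = c * 2 ^ m + b * 2 ^ (h + 1) + 2 ^ h) (hk : k = b * 2 ^ (h + 2) + a) :
    (a < 2 ^ (h + 1) - 1 →
      StirlingTwoAdic.amzEstimate n k = (StirlingTwoAdic.sigma a : ℤ) - 1 ∧
      (StirlingTwoAdic.nuS n k : ℤ) ≠ StirlingTwoAdic.amzEstimate n k ∧
      StirlingTwoAdic.sigma a ≤ StirlingTwoAdic.nuS n k) ∧
    (a = 2 ^ (h + 1) - 1 →
      StirlingTwoAdic.amzEstimate n k = (StirlingTwoAdic.sigma a : ℤ) - 1 ∧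
      StirlingTwoAdic.IsAMZC n k ∧
      (StirlingTwoAdic.nuS n k : ℤ) = (StirlingTwoAdic.sigma a : ℤ) - 1 ∧
      (StirlingTwoAdic.sigma a : ℤ) - 1 = (h : ℤ)) := by
  obtain ⟨t, rfl⟩ : ∃ t, h = t + 1 := ⟨h - 1, by omega⟩
  have hp : 0 < 2 ^ t := by positivity
  have e1 : 2 ^ (t + 1) = 2 * 2 ^ t := by ring
  have e2 : 2 ^ (t + 1 + 1) = 2 * 2 ^ (t + 1) := by ring
  have hmt : t + 1 + 1 ≤ m := by
    have h1 : 1 * 2 ^ (t + 1 + 1) ≤ b * 2 ^ (t + 1 + 1) := Nat.mul_le_mul_right _ hb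
    exact ((Nat.pow_lt_pow_iff_right (a := 2) (by norm_num)).1 (by omega)).le
  obtain ⟨M, rfl⟩ := Nat.exists_eq_add_of_le' hmt
  have hbM : b < 2 ^ M := by
    rw [pow_add 2 M] at hbm
    exact lt_of_mul_lt_mul_right (by omega) (Nat.zero_le (2 ^ (t + 1 + 1)))
  have hn' : n = c * 2 ^ (M + (t + 1 + 1)) + (b * 2 ^ (t + 1 + 1) + 2 ^ (t + 1)) := by
    rw [hn, add_assoc]
  have hcard := StirlingTwoAdic.card_twoPowers_inter_eq ha hb hc ha' hbM hn' hk hbm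
  have hmz := StirlingTwoAdic.mzEstimate_eq ha' hn' hk hbm
  have hamz : StirlingTwoAdic.amzEstimate n k = (StirlingTwoAdic.sigma a : ℤ) - 1 := by
    have h1 : StirlingTwoAdic.amzEstimate n k = StirlingTwoAdic.mzEstimate n k +
      ((StirlingTwoAdic.twoPowers n ∩ StirlingTwoAdic.twoPowers (n - k)).card : ℤ) := rfl
    rw [h1, hcard, hmz]
    ring
  set s := M + (t + 1) with hs
  have e3 : 2 ^ (M + (t + 1 + 1)) = 2 * 2 ^ s := by rw [hs]; ring
  have e4 : b * 2 ^ (t + 1 + 2) = 2 * (b * 2 ^ (t + 1 + 1)) := by ring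
  have e5 : 2 * (2 ^ t * (2 * b + 1)) = b * 2 ^ (t + 1 + 1) + 2 ^ (t + 1) := by ring
  have e7 : 2 ^ (t + 2) = 2 ^ (t + 1 + 1) := rfl
  have e8 : b * 2 ^ (t + 3) = b * 2 ^ (t + 1 + 2) := rfl
  have hB : 2 ^ t * (2 * b + 1) < 2 ^ s := by omega
  have hcs : 1 * 2 ^ (M + (t + 1 + 1)) ≤ c * 2 ^ (M + (t + 1 + 1)) :=
    Nat.mul_le_mul_right _ hc.pos
  have hbs : (b + 1) * 2 ^ (t + 1 + 1) ≤ 2 ^ (M + (t + 1 + 1)) := by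
    rw [pow_add 2 M]
    exact Nat.mul_le_mul_right _ hbM
  rw [add_mul, one_mul] at hbs
  have hkn : k ≤ n := by omega
  refine ⟨fun hlt => ?_, fun heq => ?_⟩
  · have hdvd : 2 ^ StirlingTwoAdic.sigma a ∣ Nat.stirlingSecond (n - k + k) k :=
      StirlingTwoAdic.two_pow_sigma_dvd_stirlingSecond (A := 2 ^ (t + 1 + 1) - a) (b := b) (c := c)
        (t := t) (s := s) (by omega) hb hB ha (by omega) hk (by
          rw [e5, show s + 1 = M + (t + 1 + 1) by omega]
          omega)
    rw [Nat.sub_add_cancel hkn] at hdvd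
    have : Fact (Nat.Prime 2) := ⟨Nat.prime_two⟩
    have hle : StirlingTwoAdic.sigma a ≤ StirlingTwoAdic.nuS n k :=
      (padicValNat_dvd_iff_le (StirlingTwoAdic.stirlingSecond_pos (by omega) hkn).ne').1 hdvd
    exact ⟨hamz, by omega, hle⟩
  · have hσ : StirlingTwoAdic.sigma a = t + 1 + 1 := by
      have h1 := StirlingTwoAdic.sigma_add_sigma_compl (s := t + 1 + 1) (x := a) (by omega)
      rwa [show 2 ^ (t + 1 + 1) - 1 - a = 0 by omega, StirlingTwoAdic.sigma_zero] at h1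
    have e6 : c * 2 ^ (M + (t + 1 + 1)) = 2 * (c * 2 ^ s) := by rw [e3]; ring
    have hν : StirlingTwoAdic.nuS n k = t + 1 := by
      have h1 := StirlingTwoAdic.padicValNat_stirlingSecond_eq (b := b) (c := c) (t := t) (s := s)
        (k := k) (J := c * 2 ^ s - 2 ^ t * (2 * b + 1)) hc.pos hB (by omega) (by omega)
      rwa [show 2 * (c * 2 ^ s - 2 ^ t * (2 * b + 1)) + 1 + k = n by omega] at h1
    -- The two estimates differ by `σ(c) > 0`, which excludes an MZC.
    have hσc := StirlingTwoAdic.sigma_pos hc.pos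
    refine ⟨hamz, ⟨by rw [hamz, hν, hσ]; push_cast; ring, ?_⟩, by rw [hν, hσ]; push_cast; ring,
      by rw [hσ]; push_cast; ring⟩
    rw [StirlingTwoAdic.IsMZC, hmz, hν, hσ]
    push_cast
    omega
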